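/- **Definitions.** An *unpointed Waldhausen category* is a small category $\mathcal C$ with subcategories $co\,\mathcal C$ (cofibrations $\rightarrowtail$) and $w\mathcal C$ (weak equivalences) such that: both contain all isomorphisms of $\mathcal C$; for every cofibration $C\rightarrowtail D$ and every morphism $C\to X$ the pushout $X\cup_C D$ exists and $X\to X\cup_C D$ is again a cofibration; and weak equivalences satisfy the glueing lemma (if $B\leftarrowtail A\to X$ and $B'\leftarrowtail A'\to X'$ are related by compatible weak equivalences $A\to A'$, $B\to B'$, $X\to X'$, then the induced map $X\cup_A B\to X'\cup_{A'}B'$ is a weak equivalence). A functor between such categories is *exact* if it preserves cofibrations, weak equivalences, and pushout squares along cofibrations. For $n\ge 0$ let $\mathrm{tw}[n]$ be the twisted arrow category of $[n]=\{0<\dots<n\}$: its objects are the pairs $i\le j$, with a unique morphism $(i\le j)\to(i'\le j')$ whenever $i'\le i$ and $j\le j'$. Let $w\mathrm{Cob}(\mathcal C)_n$ be the category whose objects are the functors $X\colon\mathrm{tw}[n]\to\mathcal C$, $(i\le j)\mapsto X_{ij}$, such that $X_{ij}\to X_{ik}$ is a cofibration for all $i\le j\le k$, and such that for all $i\le j\le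 k\le l$ the square $$\begin{array}{ccc} X_{jk} & \rightarrowtail & X_{jl}\\ \downarrow & & \downarrow\\ X_{ik} & \rightarrowtail & X_{il}\end{array}$$ is a pushout; its morphisms are the natural transformations that are objectwise weak equivalences. Varying $[n]$ gives a simplicial category. The *cobordism category* of $\mathcal C$ is the simplicial space $\mathrm{Cob}(\mathcal C,w\mathcal C)\colon[n]\mapsto|N_\bullet w\mathrm{Cob}(\mathcal C)_n|$, and its *classifying space* $\mathsf B\mathrm{Cob}(\mathcal C,w\mathcal C)$ is the geometric realization of this simplicial space. An exact functor $F\colon\mathcal C\to\mathcal D$ induces by postcomposition a continuous map $\mathsf B\mathrm{Cob}(F,wF)\colon\mathsf B\mathrm{Cob}(\mathcal C,w\mathcal C)\to\mathsf B\mathrm{Cob}(\mathcal D,w\mathcal D)$. Let $F,G\colon\mathcal C\to\mathcal D$ be exact functors between unpointed Waldhausen categories. A natural transformation $\phi\colon F\to G$ is a *relative isomorphism* if for every cofibration $f\colon c\rightarrowtail c'$ in $\mathcal C$ the square $$\begin{array}{ccc} F(c) & \xrightarrow{F(f)} & F(c')\\ {\scriptstyle\phi_c}\downarrow & & \downarrow{\scriptstyle\phi_{c'}}\\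 G(c) & \xrightarrow{G(f)} & G(c')\end{array}$$ is a pushout in $\mathcal D$. **Proposition 2.6.** Let $F,G\colon\mathcal C\to\mathcal D$ be exact functors between unpointed Waldhausen categories and let $\phi\colon F\to G$ be a relative isomorphism. Then the induced maps $$\mathsf B\mathrm{Cob}(F,wF),\ \mathsf B\mathrm{Cob}(G,wG)\colon \mathsf B\mathrm{Cob}(\mathcal C,w\mathcal C)\to\mathsf B\mathrm{Cob}(\mathcal D,w\mathcal D)$$ are homotopic. -/

import Mathlib

open CategoryTheory Opposite

universe v u w

namespace CobCat

/-- The structure of an *unpointed Waldhausen category* on a category `C`: cofibrations `cof` and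
weak equivalences `weq`, both closed under composition and containing all isomorphisms (hence
subcategories on all objects), such that pushouts along cofibrations exist, cofibrations are stable
under cobase change, and weak equivalences satisfy the glueing lemma. -/
class UnpointedWaldhausen (C : Type u) [Category.{v} C] where
  /-- the cofibrations -/
  cof : MorphismProperty C
  /-- the weak equivalences -/
  weq : MorphismProperty C
  cof_of_isIso : ∀ {X Y : C} (f : X ⟶ Y), IsIso f → cof f
  cof_comp : ∀ {X Y Z : C} (f : X ⟶ Y) (g : Y ⟶ Z), cof f → cof g → cof (f ≫ g)
  weq_of_isIso : ∀ {X Y : C} (f : X ⟶ Y), IsIso f → weq f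
  weq_comp : ∀ {X Y Z : C} (f : X ⟶ Y) (g : Y ⟶ Z), weq f → weq g → weq (f ≫ g)
  hasPushout_of_cof : ∀ {A B X : C} (i : A ⟶ B) (f : A ⟶ X), cof i → Limits.HasPushout i f
  cof_cobaseChange : ∀ {A B X P : C} {i : A ⟶ B} {f : A ⟶ X} {g : B ⟶ P} {j : X ⟶ P},
    IsPushout i f g j → cof i → cof j
  /-- the glueing lemma: if `(a, b, x)` is a morphism from `B ↢ A → X` to `B' ↢ A' → X'` with all
  three components weak equivalences, then the induced map `p` of pushouts is a weak equivalence -/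
  glueing : ∀ {A B X P A' B' X' P' : C}
    {i : A ⟶ B} {f : A ⟶ X} {g : B ⟶ P} {j : X ⟶ P}
    {i' : A' ⟶ B'} {f' : A' ⟶ X'} {g' : B' ⟶ P'} {j' : X' ⟶ P'}
    (a : A ⟶ A') (b : B ⟶ B') (x : X ⟶ X') (p : P ⟶ P'),
    cof i → cof i' → IsPushout i f g j → IsPushout i' f' g' j' →
    i ≫ b = a ≫ i' → f ≫ x = a ≫ f' → g ≫ p = b ≫ g' → j ≫ p = x ≫ j' →
    weq a → weq b → weq x → weq p

open UnpointedWaldhausen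

/-- A functor between unpointed Waldhausen categories is *exact* if it preserves cofibrations, weak
equivalences, and pushout squares along cofibrations. -/
structure IsExact {C : Type u} [Category.{v} C] [UnpointedWaldhausen C]
    {D : Type u} [Category.{v} D] [UnpointedWaldhausen D] (F : C ⥤ D) : Prop where
  map_cof : ∀ {X Y : C} (f : X ⟶ Y), cof f → cof (F.map f)
  map_weq : ∀ {X Y : C} (f : X ⟶ Y), weq f → weq (F.map f)
  map_isPushout : ∀ {A B X P : C} {i : A ⟶ B} {f : A ⟶ X} {g : B ⟶ P} {j : X ⟶ P},
    cof i → IsPushout i f g j → IsPushout (F.map i) (F.map f) (F.map g) (F.map j)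

/-- A natural transformation `φ : F ⟶ G` is a *relative isomorphism* if its naturality square at
every cofibration is a pushout square. -/
def IsRelativeIso {C : Type u} [Category.{v} C] [UnpointedWaldhausen C]
    {D : Type u} [Category.{v} D] {F G : C ⥤ D} (φ : F ⟶ G) : Prop :=
  ∀ ⦃c c' : C⦄ (f : c ⟶ c'), cof f → IsPushout (F.map f) (φ.app c) (φ.app c') (G.map f)

/-- The objects `i ≤ j` of the twisted arrow category of a preorder `α`. -/
@[ext]
structure Tw (α : Type) [Preorder α] where
  /-- the source `i` -/
  fst : α
  /-- the target `j` -/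
  snd : α
  le : fst ≤ snd

/-- There is a (unique) morphism from `i ≤ j` to `i' ≤ j'` iff `i' ≤ i` and `j ≤ j'`. As for every
preorder, this makes `Tw α` a category. -/
instance (α : Type) [Preorder α] : Preorder (Tw α) where
  le p q := q.fst ≤ p.fst ∧ p.snd ≤ q.snd
  le_refl _ := ⟨le_rfl, le_rfl⟩
  le_trans _ _ _ h h' := ⟨h'.1.trans h.1, h.2.trans h'.2⟩

namespace Tw

/-- The functor between twisted arrow categories induced by a monotone map. -/
def map {α β : Type} [Preorder α] [Preorder β] (θ : α →o β) : Tw α ⥤ Tw β :=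
  Monotone.functor (f := fun p => ⟨θ p.fst, θ p.snd, θ.monotone p.le⟩)
    fun _ _ h => ⟨θ.monotone h.1, θ.monotone h.2⟩

variable {α : Type} [Preorder α]

/-- The morphism `(i ≤ j) ⟶ (i ≤ k)`, for `i ≤ j ≤ k`. -/
def right {i j k : α} (hij : i ≤ j) (hjk : j ≤ k) :
    (⟨i, j, hij⟩ : Tw α) ⟶ ⟨i, k, hij.trans hjk⟩ :=
  homOfLE ⟨le_rfl, hjk⟩

/-- The morphism `(j ≤ k) ⟶ (i ≤ k)`, for `i ≤ j ≤ k`. -/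
def left {i j k : α} (hij : i ≤ j) (hjk : j ≤ k) :
    (⟨j, k, hjk⟩ : Tw α) ⟶ ⟨i, k, hij.trans hjk⟩ :=
  homOfLE ⟨hij, le_rfl⟩

end Tw

/-- The conditions on a functor `X : tw α ⥤ C` defining the objects of the cobordism category (used
for `α = [n]`): the maps `X_ij → X_ik` are cofibrations, and for `i ≤ j ≤ k ≤ l` the square
`X_jk → X_jl`, `X_jk → X_ik`, `X_jl → X_il`, `X_ik → X_il` is a pushout. -/
structure IsCob {C : Type u} [Category.{v} C] [UnpointedWaldhausen C]
    {α : Type} [Preorder α] (X : Tw α ⥤ C) : Prop where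
  cof_right : ∀ {i j k : α} (hij : i ≤ j) (hjk : j ≤ k), cof (X.map (Tw.right hij hjk))
  isPushout : ∀ {i j k l : α} (hij : i ≤ j) (hjk : j ≤ k) (hkl : k ≤ l),
    IsPushout (X.map (Tw.right hjk hkl)) (X.map (Tw.left hij hjk))
      (X.map (Tw.left hij (hjk.trans hkl))) (X.map (Tw.right (hij.trans hjk) hkl))

/-- The objects of `w Cob(C)_n`, which are those of `Cob(C)_n`. -/
structure WCob (C : Type u) [Category.{v} C] [UnpointedWaldhausen C] (n : SimplexCategory) where
  /-- the underlying functor `tw [n] ⥤ C` -/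
  functor : Tw (Fin (n.len + 1)) ⥤ C
  isCob : IsCob functor

namespace WCob

variable {C : Type u} [Category.{v} C] [UnpointedWaldhausen C]

/-- The morphisms of `w Cob(C)_n`: natural transformations that are objectwise weak equivalences. -/
@[ext]
structure Hom {n : SimplexCategory} (X Y : WCob C n) where
  /-- the underlying natural transformation -/
  nat : X.functor ⟶ Y.functor
  weq_app : ∀ p, weq (nat.app p)

/-- The category `w Cob(C)_n`. -/
instance (n : SimplexCategory) : Category.{v} (WCob C n) where
  Hom := Hom
  id X := ⟨𝟙 X.functor, fun _ => weq_of_isIso _ inferInstance⟩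
  comp f g := ⟨f.nat ≫ g.nat, fun p => weq_comp _ _ (f.weq_app p) (g.weq_app p)⟩
  id_comp f := Hom.ext (Category.id_comp f.nat)
  comp_id f := Hom.ext (Category.comp_id f.nat)
  assoc f g h := Hom.ext (Category.assoc f.nat g.nat h.nat)

/-- Restriction along `θ : [m] → [n]`, the simplicial structure of `w Cob(C)`. -/
def restrict {m n : SimplexCategory} (θ : m ⟶ n) : WCob C n ⥤ WCob C m where
  obj X :=
    { functor := Tw.map θ.toOrderHom ⋙ X.functor
      isCob :=
        { cof_right := fun hij hjk =>
            X.isCob.cof_right (θ.toOrderHom.monotone hij) (θ.toOrderHom.monotone hjk)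
          isPushout := fun hij hjk hkl =>
            X.isCob.isPushout (θ.toOrderHom.monotone hij) (θ.toOrderHom.monotone hjk)
              (θ.toOrderHom.monotone hkl) } }
  map f := ⟨Functor.whiskerLeft (Tw.map θ.toOrderHom) f.nat,
    fun p => f.weq_app ((Tw.map θ.toOrderHom).obj p)⟩
  map_id _ := rfl
  map_comp _ _ := rfl

/-- Postcomposition with an exact functor. -/
def postcomp {D : Type u} [Category.{v} D] [UnpointedWaldhausen D] {F : C ⥤ D} (hF : IsExact F)
    (n : SimplexCategory) : WCob C n ⥤ WCob D n where
  obj X :=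
    { functor := X.functor ⋙ F
      isCob :=
        { cof_right := fun hij hjk => hF.map_cof _ (X.isCob.cof_right hij hjk)
          isPushout := fun hij hjk hkl =>
            hF.map_isPushout (X.isCob.cof_right hjk hkl) (X.isCob.isPushout hij hjk hkl) } }
  map f := ⟨Functor.whiskerRight f.nat F, fun p => hF.map_weq _ (f.weq_app p)⟩
  map_id _ := Hom.ext (Functor.whiskerRight_id F)
  map_comp f g := Hom.ext (Functor.whiskerRight_comp f.nat g.nat F)

end WCob

/-- The simplicial category `w Cob(C)`. -/
def wCob (C : Type u) [Category.{v} C] [UnpointedWaldhausen C] :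
    SimplexCategoryᵒᵖ ⥤ Cat.{v, max u v} where
  obj n := Cat.of (WCob C n.unop)
  map θ := (WCob.restrict θ.unop).toCatHom
  map_id _ := rfl
  map_comp _ _ := rfl

/-- The simplicial functor `w Cob(C) ⟶ w Cob(D)` induced by an exact functor. -/
def wCobMap {C : Type u} [Category.{v} C] [UnpointedWaldhausen C]
    {D : Type u} [Category.{v} D] [UnpointedWaldhausen D] {F : C ⥤ D} (hF : IsExact F) :
    wCob C ⟶ wCob D where
  app n := (WCob.postcomp hF n.unop).toCatHom
  naturality _ _ _ := rfl

section Realization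

/-- The gluing relation in the geometric realization of a simplicial space `X`: for
`θ : [m] → [n]`, `x ∈ X_n` and `t ∈ Δ^m`, identify `(θ^* x, t)` with `(x, θ_* t)`. -/
inductive RealizationRel (X : SimplexCategoryᵒᵖ ⥤ TopCat.{w}) :
    (Σ n : SimplexCategory, X.obj (op n) × stdSimplex ℝ (Fin (n.len + 1))) →
    (Σ n : SimplexCategory, X.obj (op n) × stdSimplex ℝ (Fin (n.len + 1))) → Prop
  | glue {m n : SimplexCategory} (θ : m ⟶ n) (x : X.obj (op n))
      (t : stdSimplex ℝ (Fin (m.len + 1))) :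
      RealizationRel X ⟨m, (X.map θ.op x, t)⟩ ⟨n, (x, stdSimplex.map θ t)⟩

/-- The geometric realization `(∐ n, X_n × Δ^n) / ~` of a simplicial space, with the quotient
topology. -/
def Realization (X : SimplexCategoryᵒᵖ ⥤ TopCat.{w}) : Type w :=
  Quot (RealizationRel X)

instance (X : SimplexCategoryᵒᵖ ⥤ TopCat.{w}) : TopologicalSpace (Realization X) :=
  inferInstanceAs (TopologicalSpace (Quot (RealizationRel X)))

/-- The map on geometric realizations induced by a map of simplicial spaces. -/
def Realization.map {X Y : SimplexCategoryᵒᵖ ⥤ TopCat.{w}} (f : X ⟶ Y) :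
    C(Realization X, Realization Y) where
  toFun := Quot.map (fun p => ⟨p.1, (f.app (op p.1) p.2.1, p.2.2)⟩) (by
    rintro _ _ ⟨θ, x, t⟩
    have h : f.app _ (X.map θ.op x) = Y.map θ.op (f.app _ x) :=
      NatTrans.naturality_apply f θ.op x
    dsimp only
    rw [h]
    exact .glue θ _ t)
  continuous_toFun := by
    refine continuous_coinduced_dom.2 (continuous_quot_mk.comp (continuous_sigma fun n => ?_))
    exact continuous_sigmaMk.comp
      (((f.app (op n)).hom.continuous.comp continuous_fst).prodMk continuous_snd)

end Realization

/-- The cobordism category `Cob(C, wC)`: the simplicial space `[n] ↦ |N w Cob(C)_n|`. -/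
noncomputable def cobSpace (C : Type u) [Category.{v} C] [UnpointedWaldhausen C] :
    SimplexCategoryᵒᵖ ⥤ TopCat.{max u v} :=
  wCob C ⋙ nerveFunctor.{v, max u v} ⋙ SSet.toTop.{max u v}

/-- The map of simplicial spaces `Cob(C, wC) ⟶ Cob(D, wD)` induced by an exact functor. -/
noncomputable def cobSpaceMap {C : Type u} [Category.{v} C] [UnpointedWaldhausen C]
    {D : Type u} [Category.{v} D] [UnpointedWaldhausen D] {F : C ⥤ D} (hF : IsExact F) :
    cobSpace C ⟶ cobSpace D :=
  Functor.whiskerRight (wCobMap hF) (nerveFunctor.{v, max u v} ⋙ SSet.toTop.{max u v})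

/-- The classifying space `B Cob(C, wC)` of the cobordism category. -/
abbrev BCob (C : Type u) [Category.{v} C] [UnpointedWaldhausen C] : Type (max u v) :=
  Realization (cobSpace C)

/-- The continuous map `B Cob(C, wC) → B Cob(D, wD)` induced by an exact functor. -/
noncomputable def BCobMap {C : Type u} [Category.{v} C] [UnpointedWaldhausen C]
    {D : Type u} [Category.{v} D] [UnpointedWaldhausen D] {F : C ⥤ D} (hF : IsExact F) :
    C(BCob C, BCob D) :=
  Realization.map (cobSpaceMap hF)

end CobCat

/-! A relative isomorphism defines a simplicial homotopy `wCob C × Δ[1] ⟶ wCob D`. Given `α : [n] →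
[1]` and an object `X`, apply `F` to `X_ij` where `α i = 1` and `G` where `α i = 0`. A morphism `(i
≤ j) ⟶ (i' ≤ j')` has `i' ≤ i`, so it can only pass from `F` to `G`, and `φ` supplies the passage.
Enlarging `j` does not change the chosen functor, so the horizontal maps remain cofibrations. The
square for `i ≤ j ≤ k ≤ l` is a vertical pasting: first the naturality square of `φ` (or of an
identity) at `X_jk ↣ X_jl`, a pushout because `φ` is a relative isomorphism, then the image of the
original square under an exact functor. This is `isCob_twist`; constant `α` gives back `F` and `G`
(`WCob.twist_const`).

It remains that a simplicial homotopy of simplicial spaces realizes to a homotopy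
(`SimplicialHomotopy.homotopic`). Here `Δⁿ × [0, 1]` is cut into `n + 1` prisms; on the `k`-th, a
point `(t, s)` lifts uniquely to `v ∈ Δⁿ⁺¹` with `σ_k v = t` and with `s` the weight that `v` puts
on the vertices sent to `0` by the `k`-th cut. The homotopy sends `(x, t, s)` to the class of `(h
(σ_k^* x), v)`. Uniqueness of `v` yields agreement on overlaps and compatibility with simplicial
operators; continuity descends since the product of a quotient map with `[0, 1]` is again a quotient
map. -/

namespace CobCat

/-! ### Prism decomposition of `Δⁿ × [0, 1]` in barycentric coordinates. -/

section Prism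

open Simplicial

theorem stdSimplex_map_apply {α β : Type} [Fintype α] [Fintype β] [DecidableEq β] (f : α → β)
    (t : stdSimplex ℝ α) (b : β) : stdSimplex.map f t b = ∑ a, if f a = b then t a else 0 := by
  rw [stdSimplex.map_coe, FunOnFinite.linearMap_apply_apply, Finset.sum_filter]

/-- The pushforward collects the coordinates over each fibre of `f`, so partial sums over `P` become
partial sums over its preimage. This controls how prism boundaries move under simplicial operators.
-/
theorem sum_ite_map {α β : Type} [Fintype α] [Fintype β] [DecidableEq β] (f : α → β)
    (t : stdSimplex ℝ α) (P : β → Prop) [DecidablePred P] :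
    (∑ b, if P b then stdSimplex.map f t b else 0) = ∑ a, if P (f a) then t a else 0 := by
  simp only [stdSimplex_map_apply, Finset.ite_sum_zero]
  rw [Finset.sum_comm]
  refine Finset.sum_congr rfl fun a _ => ?_
  rw [Finset.sum_eq_single (f a)] <;> aesop

variable {n : ℕ}

/-- The morphism `[n] ⟶ [1]` sending exactly the elements `i ≤ k` to `0`. -/
def cut (k : Fin (n + 1)) : ⦋n⦌ ⟶ ⦋1⦌ :=
  SimplexCategory.Hom.mk
    { toFun := fun i => if i ≤ k then 0 else 1
      monotone' := fun i j hij => by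
        by_cases h : j ≤ k
        · simp [h, hij.trans h]
        · dsimp only
          rw [if_neg h]
          exact Fin.le_last (n := 1) _ }

theorem cut_apply (k i : Fin (n + 1)) : cut k i = if i ≤ k then (0 : Fin 2) else 1 := rfl

theorem cut_eq_zero_iff (k i : Fin (n + 1)) : cut k i = (0 : Fin 2) ↔ i ≤ k := by
  rw [cut_apply]
  split_ifs with h <;> simp [h]

/-- The sum of the barycentric coordinates of `t` strictly before `k`. -/
noncomputable def below (t : stdSimplex ℝ (Fin (n + 1))) (k : Fin (n + 1)) : ℝ :=
  ∑ i, if i < k then t i else 0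

theorem continuous_coord {α : Type} [Fintype α] (i : α) :
    Continuous fun t : stdSimplex ℝ α => t i :=
  (continuous_apply i).comp continuous_subtype_val

theorem continuous_below (k : Fin (n + 1)) :
    Continuous fun t : stdSimplex ℝ (Fin (n + 1)) => below t k := by
  refine continuous_finsetSum _ fun i _ => ?_
  split_ifs
  · exact continuous_coord i
  · exact continuous_const

theorem below_add (t : stdSimplex ℝ (Fin (n + 1))) (k : Fin (n + 1)) :
    below t k + t k = ∑ i, if i ≤ k then t i else 0 := by
  have h : t k = ∑ i, if i = k then t i else 0 := by simp
  rw [below, h, ← Finset.sum_add_distrib]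
  refine Finset.sum_congr rfl fun i _ => ?_
  rcases lt_trichotomy i k with h | h | h
  · simp [h, h.le, h.ne]
  · simp [h]
  · simp [h.not_gt, h.not_ge, h.ne']

theorem map_cut_apply_zero (t : stdSimplex ℝ (Fin (n + 1))) (k : Fin (n + 1)) :
    (stdSimplex.map (cut k) t : stdSimplex ℝ (Fin 2)) 0 = below t k + t k := by
  rw [below_add, stdSimplex_map_apply]
  exact Finset.sum_congr rfl fun i _ => if_congr (cut_eq_zero_iff k i) rfl rfl

/-- The `k`-th prism in the standard decomposition of `Δⁿ × ℝ`. -/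
def prism (k : Fin (n + 1)) : Set (stdSimplex ℝ (Fin (n + 1)) × ℝ) :=
  {p | below p.1 k ≤ p.2 ∧ p.2 ≤ below p.1 k + p.1 k}

theorem isClosed_prism (k : Fin (n + 1)) : IsClosed (prism k) :=
  (isClosed_le ((continuous_below k).comp continuous_fst) continuous_snd).inter
    (isClosed_le continuous_snd
      (((continuous_below k).comp continuous_fst).add ((continuous_coord k).comp continuous_fst)))

theorem below_succ (t : stdSimplex ℝ (Fin (n + 2))) (k : Fin (n + 1)) :
    below t k.succ = below t k.castSucc + t k.castSucc := by
  rw [below_add, below]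
  simp [Fin.lt_def, Fin.le_def]

theorem below_zero (t : stdSimplex ℝ (Fin (n + 1))) : below t 0 = 0 := by
  simp [below]

theorem below_last_add (t : stdSimplex ℝ (Fin (n + 1))) :
    below t (Fin.last n) + t (Fin.last n) = 1 := by
  rw [below_add]
  simp [Fin.le_last]

theorem below_mono (t : stdSimplex ℝ (Fin (n + 1))) {k l : Fin (n + 1)} (h : k < l) :
    below t k + t k ≤ below t l := by
  rw [below_add, below]
  refine Finset.sum_le_sum fun i _ => ?_
  by_cases hi : i ≤ k
  · simp [hi, hi.trans_lt h]
  · rw [if_neg hi]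
    split_ifs
    · exact stdSimplex.zero_le t i
    · exact le_rfl

/-- The intervals `[below t k, below t k + t k]` are consecutive and end at `1`. If `s` avoided all
of them it would lie beyond the end of each, hence beyond `1`. -/
theorem exists_mem_prism (t : stdSimplex ℝ (Fin (n + 1))) {s : ℝ} (h0 : 0 ≤ s) (h1 : s ≤ 1) :
    ∃ k, (t, s) ∈ prism k := by
  by_contra! h
  have key : ∀ k : Fin (n + 1), below t k + t k < s := by
    intro k
    induction k using Fin.induction with
    | zero =>
      by_contra! h'
      exact h 0 ⟨by simpa [below_zero] using h0, h'⟩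
    | succ k ih =>
      by_contra! h'
      obtain _ | n := n
      · exact k.elim0
      · exact h k.succ ⟨by rw [below_succ]; exact ih.le, h'⟩
  have := key (Fin.last n)
  rw [below_last_add] at this
  exact this.not_ge h1

/-- The barycentric coordinates of a point of the `k`-th prism, viewed as an
`(n + 1)`-simplex. -/
noncomputable def prismCoord (k : Fin (n + 1)) (p : stdSimplex ℝ (Fin (n + 1)) × ℝ) :
    Fin (n + 2) → ℝ :=
  Fin.insertNth k.castSucc (p.2 - below p.1 k)
    fun i => if i = k then below p.1 k + p.1 k - p.2 else p.1 i

theorem prismCoord_same (k : Fin (n + 1)) (p : stdSimplex ℝ (Fin (n + 1)) × ℝ) :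
    prismCoord k p k.castSucc = p.2 - below p.1 k :=
  Fin.insertNth_apply_same (α := fun _ => ℝ) _ _ _

theorem prismCoord_succAbove (k : Fin (n + 1)) (p : stdSimplex ℝ (Fin (n + 1)) × ℝ)
    (i : Fin (n + 1)) : prismCoord k p (k.castSucc.succAbove i) =
      if i = k then below p.1 k + p.1 k - p.2 else p.1 i :=
  Fin.insertNth_apply_succAbove (α := fun _ => ℝ) _ _ _ _

theorem continuous_prismCoord (k : Fin (n + 1)) : Continuous (prismCoord k) := by
  have hb := (continuous_below k).comp (continuous_fst (Y := ℝ))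
  refine continuous_pi fun i => ?_
  revert i
  rw [Fin.forall_iff_succAbove k.castSucc]
  refine ⟨?_, fun i => ?_⟩
  · simp only [prismCoord_same]
    exact continuous_snd.sub hb
  · simp only [prismCoord_succAbove]
    split_ifs
    · exact (hb.add ((continuous_coord k).comp continuous_fst)).sub continuous_snd
    · exact (continuous_coord i).comp continuous_fst

theorem prismCoord_mem {k : Fin (n + 1)} {p : stdSimplex ℝ (Fin (n + 1)) × ℝ} (hp : p ∈ prism k) :
    prismCoord k p ∈ stdSimplex ℝ (Fin (n + 2)) := by
  refine ⟨?_, ?_⟩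
  · rw [Fin.forall_iff_succAbove k.castSucc]
    refine ⟨?_, fun i => ?_⟩
    · rw [prismCoord_same]
      exact sub_nonneg.2 hp.1
    · rw [prismCoord_succAbove]
      split_ifs
      · exact sub_nonneg.2 hp.2
      · exact stdSimplex.zero_le p.1 i
  · rw [Fin.sum_univ_succAbove _ k.castSucc, prismCoord_same]
    simp only [prismCoord_succAbove]
    have h := stdSimplex.sum_eq_one p.1
    have h' : ∑ i, (if i = k then below p.1 k + p.1 k - p.2 else p.1 i) =
        ∑ i, p.1 i + ∑ i, (if i = k then below p.1 k - p.2 else 0) := by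
      rw [← Finset.sum_add_distrib]
      refine Finset.sum_congr rfl fun i _ => ?_
      split_ifs with hi
      · rw [hi]; ring
      · ring
    rw [h', h, Finset.sum_ite_eq' Finset.univ k, if_pos (Finset.mem_univ k)]
    ring

/-- A point of the `k`-th prism, viewed as a point of an `(n + 1)`-simplex. -/
noncomputable def prismPoint {k : Fin (n + 1)} (p : prism k) : stdSimplex ℝ (Fin (n + 2)) :=
  ⟨prismCoord k p, prismCoord_mem p.2⟩

theorem continuous_prismPoint (k : Fin (n + 1)) : Continuous (prismPoint (k := k)) :=
  Continuous.subtype_mk ((continuous_prismCoord k).comp continuous_subtype_val) _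

theorem map_σ_apply (k : Fin (n + 1)) (v : stdSimplex ℝ (Fin (n + 2))) (j : Fin (n + 1)) :
    (stdSimplex.map (SimplexCategory.σ k) v : stdSimplex ℝ (Fin (n + 1))) j =
      v (k.castSucc.succAbove j) + if j = k then v k.castSucc else 0 := by
  rw [stdSimplex_map_apply]
  change (∑ i, if k.predAbove i = j then v i else 0) = _
  rw [Fin.sum_univ_succAbove _ k.castSucc]
  simp only [Fin.predAbove_succAbove, Fin.predAbove_castSucc_self, Finset.sum_ite_eq',
    Finset.mem_univ, if_true, eq_comm (a := k)]
  rw [add_comm]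

theorem map_cut_castSucc_apply_zero (k : Fin (n + 1)) (v : stdSimplex ℝ (Fin (n + 2))) :
    (stdSimplex.map (cut k.castSucc) v : stdSimplex ℝ (Fin 2)) 0 =
      v k.castSucc + ∑ i, if i < k then v (k.castSucc.succAbove i) else 0 := by
  rw [map_cut_apply_zero, below_add, Fin.sum_univ_succAbove _ k.castSucc, if_pos le_rfl]
  congr 1
  refine Finset.sum_congr rfl fun i _ => if_congr ?_ rfl rfl
  rcases lt_or_ge i k with h | h
  · rw [Fin.succAbove_of_castSucc_lt _ _ (Fin.castSucc_lt_castSucc_iff.2 h)]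
    simp [h, h.le]
  · rw [Fin.succAbove_of_le_castSucc _ _ (Fin.castSucc_le_castSucc_iff.2 h)]
    simp [h.not_gt, Fin.le_def]

/-- `prismCoord` splits `t k` into `s - below t k` and `below t k + t k - s`, which `σ k` adds up
again. -/
theorem map_σ_prismPoint {k : Fin (n + 1)} (p : prism k) :
    stdSimplex.map (SimplexCategory.σ k) (prismPoint p) = p.1.1 := by
  refine stdSimplex.ext (funext fun j => (map_σ_apply k _ j).trans ?_)
  have h := prismCoord_succAbove k p j
  have h' := prismCoord_same k p
  change prismCoord k p _ + (if _ then prismCoord k p _ else _) = _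
  rw [h, h']
  split_ifs with hj
  · rw [hj]; ring
  · ring

theorem map_cut_prismPoint {k : Fin (n + 1)} (p : prism k) :
    (stdSimplex.map (cut k.castSucc) (prismPoint p) : stdSimplex ℝ (Fin 2)) 0 = p.1.2 := by
  rw [map_cut_castSucc_apply_zero]
  change prismCoord k p _ + ∑ i : Fin (n + 1), (if i < k then prismCoord k p _ else 0) = _
  rw [prismCoord_same]
  simp only [prismCoord_succAbove]
  have : ∑ i, (if i < k then (if i = k then below p.1.1 k + p.1.1 k - p.1.2 else p.1.1 i) else 0)
      = below p.1.1 k := by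
    refine Finset.sum_congr rfl fun i _ => ?_
    split_ifs with h h'
    · exact absurd h' h.ne
    · rfl
    · rfl
  rw [this]
  ring

/-- Only the splitting of the `k`-th coordinate is lost under `σ k`. The cut recovers it: its weight
is `v k.castSucc` plus the earlier coordinates, which `σ k` already determines. -/
theorem eq_of_map_σ_of_map_cut (k : Fin (n + 1)) {v w : stdSimplex ℝ (Fin (n + 2))}
    (hσ : (stdSimplex.map (SimplexCategory.σ k) v : stdSimplex ℝ (Fin (n + 1))) =
      stdSimplex.map (SimplexCategory.σ k) w)
    (hcut : (stdSimplex.map (cut k.castSucc) v : stdSimplex ℝ (Fin 2)) 0 =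
      (stdSimplex.map (cut k.castSucc) w : stdSimplex ℝ (Fin 2)) 0) : v = w := by
  have h : ∀ j, v (k.castSucc.succAbove j) + (if j = k then v k.castSucc else 0) =
      w (k.castSucc.succAbove j) + if j = k then w k.castSucc else 0 := fun j => by
    rw [← map_σ_apply, ← map_σ_apply, hσ]
  have hk : v k.castSucc = w k.castSucc := by
    rw [map_cut_castSucc_apply_zero, map_cut_castSucc_apply_zero] at hcut
    have : ∑ i, (if i < k then v (k.castSucc.succAbove i) else 0) =
        ∑ i, (if i < k then w (k.castSucc.succAbove i) else 0) := by
      refine Finset.sum_congr rfl fun i _ => ?_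
      split_ifs with hi
      · simpa [hi.ne] using h i
      · rfl
    linarith
  refine stdSimplex.ext (funext ?_)
  rw [Fin.forall_iff_succAbove k.castSucc]
  refine ⟨hk, fun j => ?_⟩
  have := h j
  rw [hk] at this
  exact add_right_cancel this

theorem stdSimplex_map_comp {l m n : SimplexCategory} (f : l ⟶ m) (g : m ⟶ n)
    (t : stdSimplex ℝ (Fin (l.len + 1))) :
    (stdSimplex.map (f ≫ g) t : stdSimplex ℝ (Fin (n.len + 1))) =
      stdSimplex.map g (stdSimplex.map f t : stdSimplex ℝ (Fin (m.len + 1))) :=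
  (stdSimplex.map_comp_apply f g t).symm

theorem stdSimplex_map_id (n : SimplexCategory) (t : stdSimplex ℝ (Fin (n.len + 1))) :
    (stdSimplex.map (𝟙 n) t : stdSimplex ℝ (Fin (n.len + 1))) = t :=
  stdSimplex.map_id_apply t

/-- This is how points of an `(n + 1)`-simplex are identified below: it is enough to compare their
two projections. -/
theorem map_eq_prismPoint {k : Fin (n + 1)} (p : prism k) {m : SimplexCategory} (ι : m ⟶ ⦋n + 1⦌)
    (t : stdSimplex ℝ (Fin (m.len + 1)))
    (hσ : stdSimplex.map (ι ≫ SimplexCategory.σ k) t = p.1.1)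
    (hcut : (stdSimplex.map (ι ≫ cut k.castSucc) t : stdSimplex ℝ (Fin 2)) 0 = p.1.2) :
    stdSimplex.map ι t = prismPoint p := by
  refine eq_of_map_σ_of_map_cut k ?_ ?_
  · rw [map_σ_prismPoint, ← hσ]
    exact (stdSimplex_map_comp ι (SimplexCategory.σ k) t).symm
  · rw [map_cut_prismPoint, ← hcut]
    exact congrArg (fun x : stdSimplex ℝ (Fin 2) => x 0)
      (stdSimplex_map_comp ι (cut k.castSucc) t).symm

/-! ### Compatibility of the prisms with simplicial operators. -/

/-- The map `[m + 1] ⟶ [n + 1]` covering `θ : [m] ⟶ [n]` that carries the `k`-th prism of `Δᵐ × ℝ`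
to the `θ k`-th prism of `Δⁿ × ℝ`. -/
def prismLift {m : ℕ} (θ : ⦋m⦌ ⟶ ⦋n⦌) (k : Fin (m + 1)) : ⦋m + 1⦌ ⟶ ⦋n + 1⦌ :=
  SimplexCategory.Hom.mk
    { toFun := fun i => if i ≤ k.castSucc then (θ.toOrderHom (k.predAbove i)).castSucc
        else (θ.toOrderHom (k.predAbove i)).succ
      monotone' := fun i j hij => by
        have h := θ.toOrderHom.monotone (Fin.predAbove_right_monotone k hij)
        dsimp only
        split_ifs with h₁ h₂ h₂
        · exact Fin.castSucc_le_castSucc_iff.2 h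
        · exact (Fin.castSucc_le_castSucc_iff.2 h).trans (Fin.castSucc_lt_succ).le
        · exact absurd (hij.trans h₂) h₁
        · exact Fin.succ_le_succ_iff.2 h }

theorem predAbove_le_of_le {k : Fin (n + 1)} {i : Fin (n + 2)} (h : i ≤ k.castSucc) :
    k.predAbove i ≤ k := by
  simpa using Fin.predAbove_right_monotone k h

theorem le_predAbove_of_lt {k : Fin (n + 1)} {i : Fin (n + 2)} (h : k.castSucc < i) :
    k ≤ k.predAbove i := by
  simpa using Fin.predAbove_right_monotone k h.le

theorem prismLift_σ {m : ℕ} (θ : ⦋m⦌ ⟶ ⦋n⦌) (k : Fin (m + 1)) :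
    prismLift θ k ≫ SimplexCategory.σ (θ.toOrderHom k) = SimplexCategory.σ k ≫ θ := by
  refine SimplexCategory.Hom.ext _ _ (OrderHom.ext _ _ (funext fun i => ?_))
  change (θ.toOrderHom k).predAbove (if i ≤ k.castSucc then _ else _) =
    θ.toOrderHom (k.predAbove i)
  split_ifs with h
  · exact Fin.predAbove_castSucc_of_le _ _ (θ.toOrderHom.monotone (predAbove_le_of_le h))
  · exact Fin.predAbove_succ_of_le _ _
      (θ.toOrderHom.monotone (le_predAbove_of_lt (not_le.1 h)))

theorem prismLift_cut {m : ℕ} (θ : ⦋m⦌ ⟶ ⦋n⦌) (k : Fin (m + 1)) :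
    prismLift θ k ≫ cut (θ.toOrderHom k).castSucc = cut k.castSucc := by
  refine SimplexCategory.Hom.ext _ _ (OrderHom.ext _ _ (funext fun i => ?_))
  refine if_congr (?_ : (if i ≤ k.castSucc then _ else _) ≤ (θ.toOrderHom k).castSucc ↔ _) rfl rfl
  split_ifs with h
  · exact iff_of_true
      (Fin.castSucc_le_castSucc_iff.2 (θ.toOrderHom.monotone (predAbove_le_of_le h))) h
  · refine iff_of_false (not_le.2 ?_) h
    exact (Fin.castSucc_le_castSucc_iff.2
      (θ.toOrderHom.monotone (le_predAbove_of_lt (not_le.1 h)))).trans_lt Fin.castSucc_lt_succ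

/-- By monotonicity, `θ i < θ k` forces `i < k`, so the lower bound can only decrease; and `i ≤ k`
forces `θ i ≤ θ k`, so the upper bound can only increase. -/
theorem map_mem_prism {m : ℕ} (θ : ⦋m⦌ ⟶ ⦋n⦌) {k : Fin (m + 1)} {t : stdSimplex ℝ (Fin (m + 1))}
    {s : ℝ} (h : (t, s) ∈ prism k) :
    ((stdSimplex.map θ t : stdSimplex ℝ (Fin (n + 1))), s) ∈ prism (θ.toOrderHom k) := by
  constructor
  · refine le_trans ?_ h.1
    change (∑ j, if j < θ.toOrderHom k then stdSimplex.map θ.toOrderHom t j else 0) ≤ _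
    rw [sum_ite_map, below]
    refine Finset.sum_le_sum fun i _ => ?_
    by_cases hi : θ.toOrderHom i < θ.toOrderHom k
    · simp [hi, θ.toOrderHom.monotone.reflect_lt hi]
    · rw [if_neg hi]
      split_ifs
      · exact stdSimplex.zero_le t i
      · exact le_rfl
  · refine h.2.trans ?_
    simp only [below_add]
    change _ ≤ ∑ j, if j ≤ θ.toOrderHom k then stdSimplex.map θ.toOrderHom t j else 0
    rw [sum_ite_map]
    refine Finset.sum_le_sum fun i _ => ?_
    by_cases hi : i ≤ k
    · simp [hi, θ.toOrderHom.monotone hi]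
    · rw [if_neg hi]
      split_ifs
      · exact stdSimplex.zero_le t i
      · exact le_rfl

end Prism

end CobCat

namespace CobCat

/-! ### Realization of a simplicial homotopy. -/

section Homotopy

open Simplicial unitInterval

/-- A simplicial homotopy `X × Δ[1] ⟶ Y` between maps of simplicial spaces. -/
structure SimplicialHomotopy {X Y : SimplexCategoryᵒᵖ ⥤ TopCat.{w}} (f g : X ⟶ Y) where
  /-- the component of the homotopy at a simplex of `Δ[1]` -/
  map : ∀ {n : SimplexCategory} (_ : n ⟶ ⦋1⦌), X.obj (op n) ⟶ Y.obj (op n)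
  naturality : ∀ {m n : SimplexCategory} (θ : m ⟶ n) (α : n ⟶ ⦋1⦌),
    X.map θ.op ≫ map (θ ≫ α) = map α ≫ Y.map θ.op
  map_one : ∀ {n : SimplexCategory} (α : n ⟶ ⦋1⦌),
    (∀ i, α.toOrderHom i = 1) → map α = f.app (op n)
  map_zero : ∀ {n : SimplexCategory} (α : n ⟶ ⦋1⦌),
    (∀ i, α.toOrderHom i = 0) → map α = g.app (op n)

namespace SimplicialHomotopy

variable {X Y : SimplexCategoryᵒᵖ ⥤ TopCat.{w}} {f g : X ⟶ Y} (h : SimplicialHomotopy f g) {n : ℕ}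

/-- The homotopy on realizations, on the product of `X_n` with the `k`-th prism of `Δⁿ × ℝ`. -/
noncomputable def onPrism (k : Fin (n + 1)) (x : X.obj (op ⦋n⦌)) (p : prism k) : Realization Y :=
  Quot.mk _ ⟨⦋n + 1⦌, (h.map (cut k.castSucc) (X.map (SimplexCategory.σ k).op x), prismPoint p)⟩

theorem continuous_onPrism (k : Fin (n + 1)) :
    Continuous fun q : X.obj (op ⦋n⦌) × prism k => h.onPrism k q.1 q.2 := by
  refine continuous_quot_mk.comp (continuous_sigmaMk.comp (Continuous.prodMk ?_ ?_))
  · exact (h.map (cut k.castSucc)).hom.continuous.comp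
      ((X.map (SimplexCategory.σ k).op).hom.continuous.comp continuous_fst)
  · exact (continuous_prismPoint k).comp continuous_snd

/-- Naturality of the homotopy along `ι` combined with the gluing relation in `Realization Y`: the
value may be computed on any simplex through which the prism point factors. -/
theorem onPrism_eq (k : Fin (n + 1)) (x : X.obj (op ⦋n⦌)) (p : prism k) {m : SimplexCategory}
    (ι : m ⟶ ⦋n + 1⦌) (t : stdSimplex ℝ (Fin (m.len + 1))) (ht : stdSimplex.map ι t = prismPoint p) :
    h.onPrism k x p = Quot.mk _ ⟨m, (h.map (ι ≫ cut k.castSucc)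
      (X.map (ι ≫ SimplexCategory.σ k).op x), t)⟩ := by
  have e : h.map (ι ≫ cut k.castSucc) (X.map (ι ≫ SimplexCategory.σ k).op x) =
      Y.map ι.op (h.map (cut k.castSucc) (X.map (SimplexCategory.σ k).op x)) := by
    rw [op_comp, X.map_comp, TopCat.comp_app]
    exact ConcreteCategory.congr_hom (h.naturality ι (cut k.castSucc)) _
  rw [e, onPrism, ← ht]
  exact (Quot.sound (RealizationRel.glue ι _ t)).symm

/-- On the top and bottom faces of a prism the lift comes from a section `ι` of `σ k`, so the
degeneracy on `x` cancels and the value no longer mentions `k`, only the map `α`. -/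
theorem onPrism_section (k : Fin (n + 1)) (x : X.obj (op ⦋n⦌)) (p : prism k)
    (ι : ⦋n⦌ ⟶ ⦋n + 1⦌) (α : ⦋n⦌ ⟶ ⦋1⦌) (hι : ι ≫ SimplexCategory.σ k = 𝟙 _)
    (hα : ι ≫ cut k.castSucc = α) (hs : (stdSimplex.map α p.1.1 : stdSimplex ℝ (Fin 2)) 0 = p.1.2) :
    h.onPrism k x p = Quot.mk _ ⟨⦋n⦌, (h.map α x, p.1.1)⟩ := by
  subst hα
  rw [h.onPrism_eq k x p ι p.1.1, hι, op_id, X.map_id, TopCat.id_app]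
  refine map_eq_prismPoint p ι p.1.1 ?_ hs
  rw [hι]
  exact stdSimplex_map_id ⦋n⦌ p.1.1

/-- `prismLift θ k` commutes with both projections, so it carries the lift of `(t, s)` to the lift
of `(θ t, s)`. -/
theorem onPrism_map {m : ℕ} (θ : ⦋m⦌ ⟶ ⦋n⦌) (k : Fin (m + 1)) (x : X.obj (op ⦋n⦌))
    (t : stdSimplex ℝ (Fin (m + 1))) (s : ℝ) (hp : (t, s) ∈ prism k) :
    h.onPrism k (X.map θ.op x) ⟨(t, s), hp⟩ =
      h.onPrism (θ.toOrderHom k) x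
        ⟨((stdSimplex.map θ t : stdSimplex ℝ (Fin (n + 1))), s), map_mem_prism θ hp⟩ := by
  rw [h.onPrism_eq (θ.toOrderHom k) x ⟨_, map_mem_prism θ hp⟩ (prismLift θ k)
    (prismPoint ⟨(t, s), hp⟩), prismLift_cut, prismLift_σ, op_comp, X.map_comp, TopCat.comp_app]
  · rfl
  · refine map_eq_prismPoint _ _ _ ?_ ?_
    · rw [prismLift_σ]
      refine (stdSimplex_map_comp (SimplexCategory.σ k) θ _).trans ?_
      exact congrArg (fun t : stdSimplex ℝ (Fin (m + 1)) =>
        (stdSimplex.map θ t : stdSimplex ℝ (Fin (n + 1)))) (map_σ_prismPoint ⟨(t, s), hp⟩)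
    · rw [prismLift_cut]
      exact map_cut_prismPoint ⟨(t, s), hp⟩

theorem δ_comp_cut_castSucc (k : Fin (n + 1)) :
    SimplexCategory.δ k.succ ≫ cut k.castSucc = cut k := by
  refine SimplexCategory.Hom.ext _ _ (OrderHom.ext _ _ (funext fun i => ?_))
  refine if_congr (?_ : k.succ.succAbove i ≤ k.castSucc ↔ i ≤ k) rfl rfl
  rcases le_or_gt i k with hi | hi
  · rw [Fin.succAbove_of_castSucc_lt _ _ (Fin.castSucc_lt_succ_iff.2 hi)]
    exact Fin.castSucc_le_castSucc_iff
  · rw [Fin.succAbove_of_le_castSucc _ _ (Fin.succ_le_castSucc_iff.2 hi)]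
    exact iff_of_false
      (not_le.2 ((Fin.castSucc_lt_castSucc_iff.2 hi).trans Fin.castSucc_lt_succ)) (not_le.2 hi)

theorem δ_comp_cut_succ (k : Fin n) :
    SimplexCategory.δ k.succ.castSucc ≫ cut k.succ.castSucc = cut k.castSucc := by
  refine SimplexCategory.Hom.ext _ _ (OrderHom.ext _ _ (funext fun i => ?_))
  refine if_congr (?_ : k.succ.castSucc.succAbove i ≤ k.succ.castSucc ↔ i ≤ k.castSucc) rfl rfl
  rcases lt_or_ge i k.succ with hi | hi
  · rw [Fin.succAbove_of_castSucc_lt _ _ (Fin.castSucc_lt_castSucc_iff.2 hi)]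
    exact iff_of_true (Fin.castSucc_le_castSucc_iff.2 hi.le) (Fin.le_castSucc_iff.2 hi)
  · rw [Fin.succAbove_of_le_castSucc _ _ (Fin.castSucc_le_castSucc_iff.2 hi)]
    exact iff_of_false
      (not_le.2 ((Fin.castSucc_le_castSucc_iff.2 hi).trans_lt Fin.castSucc_lt_succ))
      (not_le.2 (Fin.castSucc_lt_succ.trans_le hi))

/-- Two adjacent prisms meet where `s` is the sum of the coordinates up to `k`. The common face is
`δ` at `k + 1` in both, and the two cuts restrict to the same map on it. -/
theorem onPrism_succ (k : Fin n) (x : X.obj (op ⦋n⦌)) (p : stdSimplex ℝ (Fin (n + 1)) × ℝ)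
    (h₁ : p ∈ prism k.castSucc) (h₂ : p ∈ prism k.succ) :
    h.onPrism k.castSucc x ⟨p, h₁⟩ = h.onPrism k.succ x ⟨p, h₂⟩ := by
  have hs : (stdSimplex.map (cut k.castSucc) p.1 : stdSimplex ℝ (Fin 2)) 0 = p.2 := by
    rw [map_cut_apply_zero]
    exact le_antisymm ((below_mono p.1 Fin.castSucc_lt_succ).trans h₂.1) h₁.2
  rw [h.onPrism_section k.castSucc x ⟨p, h₁⟩ (SimplexCategory.δ k.castSucc.succ) (cut k.castSucc)
      SimplexCategory.δ_comp_σ_succ (δ_comp_cut_castSucc k.castSucc) hs,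
    h.onPrism_section k.succ x ⟨p, h₂⟩ (SimplexCategory.δ k.succ.castSucc) (cut k.castSucc)
      SimplexCategory.δ_comp_σ_self (δ_comp_cut_succ k) hs]

theorem onPrism_eq_of_le (x : X.obj (op ⦋n⦌)) (p : stdSimplex ℝ (Fin (n + 1)) × ℝ)
    {k : Fin (n + 1)} (hk : p ∈ prism k) (l : Fin (n + 1)) (hl : p ∈ prism l) (hkl : k ≤ l) :
    h.onPrism k x ⟨p, hk⟩ = h.onPrism l x ⟨p, hl⟩ := by
  induction l using Fin.induction with
  | zero =>
    obtain rfl : k = 0 := Fin.le_zero_iff.1 hkl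
    rfl
  | succ l ih =>
    rcases hkl.eq_or_lt with rfl | hlt
    · rfl
    · have hkl' : k ≤ l.castSucc := Fin.le_castSucc_iff.2 hlt
      have h₁ : below p.1 k ≤ below p.1 l.castSucc := by
        rcases hkl'.eq_or_lt with rfl | hlt'
        · exact le_rfl
        · exact (le_add_of_nonneg_right (stdSimplex.zero_le p.1 k)).trans (below_mono p.1 hlt')
      have h₂ : below p.1 k + p.1 k ≤ below p.1 l.castSucc + p.1 l.castSucc := by
        rcases hkl'.eq_or_lt with rfl | hlt'
        · exact le_rfl
        · exact (below_mono p.1 hlt').trans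
            (le_add_of_nonneg_right (stdSimplex.zero_le p.1 l.castSucc))
      -- The prism intervals are ordered, so a point common to the prisms `k` and `l + 1` also lies
      -- in every prism between them; this reduces to adjacent prisms.
      have hmem : p ∈ prism l.castSucc :=
        ⟨(le_add_of_nonneg_right (stdSimplex.zero_le p.1 l.castSucc)).trans
          ((below_mono p.1 Fin.castSucc_lt_succ).trans hl.1), hk.2.trans h₂⟩
      exact (ih hmem hkl').trans (h.onPrism_succ l x p hmem hl)

theorem onPrism_congr (x : X.obj (op ⦋n⦌)) (p : stdSimplex ℝ (Fin (n + 1)) × ℝ)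
    {k l : Fin (n + 1)} (hk : p ∈ prism k) (hl : p ∈ prism l) :
    h.onPrism k x ⟨p, hk⟩ = h.onPrism l x ⟨p, hl⟩ := by
  rcases le_total k l with hkl | hkl
  · exact h.onPrism_eq_of_le x p hk l hl hkl
  · exact (h.onPrism_eq_of_le x p hl k hk hkl).symm

/-- The homotopy on realizations, on `X_n × Δⁿ × [0, 1]`. -/
noncomputable def onSimplex (x : X.obj (op ⦋n⦌)) (t : stdSimplex ℝ (Fin (n + 1))) (s : I) :
    Realization Y :=
  h.onPrism _ x ⟨(t, (s : ℝ)), (exists_mem_prism t s.2.1 s.2.2).choose_spec⟩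

theorem onSimplex_eq (x : X.obj (op ⦋n⦌)) (t : stdSimplex ℝ (Fin (n + 1))) (s : I)
    {k : Fin (n + 1)} (hk : (t, (s : ℝ)) ∈ prism k) :
    h.onSimplex x t s = h.onPrism k x ⟨(t, s), hk⟩ :=
  h.onPrism_congr x (t, (s : ℝ)) _ hk

theorem continuous_onSimplex :
    Continuous fun q : (X.obj (op ⦋n⦌) × stdSimplex ℝ (Fin (n + 1))) × I =>
      h.onSimplex q.1.1 q.1.2 q.2 := by
  have hc : Continuous fun q : (X.obj (op ⦋n⦌) × stdSimplex ℝ (Fin (n + 1))) × I =>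
      (q.1.2, (q.2 : ℝ)) := by fun_prop
  -- Finitely many closed prisms cover the product, so continuity on each suffices.
  refine (locallyFinite_of_finite fun k : Fin (n + 1) => (fun q : (X.obj (op ⦋n⦌) ×
    stdSimplex ℝ (Fin (n + 1))) × I => (q.1.2, (q.2 : ℝ))) ⁻¹' prism k).continuous ?_
    (fun k => (isClosed_prism k).preimage hc) fun k => ?_
  · refine Set.eq_univ_of_forall fun q => Set.mem_iUnion.2 ?_
    exact exists_mem_prism q.1.2 q.2.2.1 q.2.2.2
  · rw [continuousOn_iff_continuous_domRestrict]
    refine ((h.continuous_onPrism k).comp (g := fun q : X.obj (op ⦋n⦌) × prism k =>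
      h.onPrism k q.1 q.2) (f := fun q => (q.1.1.1, ⟨(q.1.1.2, (q.1.2 : ℝ)), q.2⟩)) ?_).congr ?_
    · exact (continuous_fst.comp (continuous_fst.comp continuous_subtype_val)).prodMk
        ((hc.comp continuous_subtype_val).subtype_mk _)
    · intro q
      exact (h.onSimplex_eq q.1.1.1 q.1.1.2 q.1.2 q.2).symm

theorem onSimplex_map {m : ℕ} (θ : ⦋m⦌ ⟶ ⦋n⦌) (x : X.obj (op ⦋n⦌))
    (t : stdSimplex ℝ (Fin (m + 1))) (s : I) :
    h.onSimplex (X.map θ.op x) t s = h.onSimplex x (stdSimplex.map θ t) s := by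
  obtain ⟨k, hk⟩ := exists_mem_prism t s.2.1 s.2.2
  rw [h.onSimplex_eq _ _ _ hk]
  exact (h.onPrism_map θ k x t s hk).trans (h.onSimplex_eq _ _ _ (map_mem_prism θ hk)).symm

theorem onSimplex_zero (x : X.obj (op ⦋n⦌)) (t : stdSimplex ℝ (Fin (n + 1))) :
    h.onSimplex x t 0 = Quot.mk _ ⟨⦋n⦌, (f.app _ x, t)⟩ := by
  have hk : (t, ((0 : I) : ℝ)) ∈ prism 0 :=
    ⟨(below_zero t).le, by rw [below_zero, zero_add]; exact stdSimplex.zero_le t 0⟩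
  -- At `s = 0` the relevant face is `δ 0`, which skips the only vertex that the cut sends to `0`.
  have hα : ∀ i, (SimplexCategory.δ (Fin.castSucc (0 : Fin (n + 1))) ≫
      cut (Fin.castSucc 0)).toOrderHom i = (1 : Fin 2) :=
    fun i => if_neg (α := Fin 2) (t := 0) (not_le.2 (Fin.succ_pos i))
  rw [h.onSimplex_eq _ _ _ hk, h.onPrism_section 0 x ⟨_, hk⟩ (SimplexCategory.δ (Fin.castSucc 0)) _
    SimplexCategory.δ_comp_σ_self rfl, h.map_one _ hα]
  refine (stdSimplex_map_apply _ t (0 : Fin 2)).trans (Finset.sum_eq_zero fun i _ => if_neg ?_)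
  exact fun h0 => zero_ne_one (h0.symm.trans (hα i))

theorem onSimplex_one (x : X.obj (op ⦋n⦌)) (t : stdSimplex ℝ (Fin (n + 1))) :
    h.onSimplex x t 1 = Quot.mk _ ⟨⦋n⦌, (g.app _ x, t)⟩ := by
  have hk : (t, ((1 : I) : ℝ)) ∈ prism (Fin.last n) := by
    refine ⟨?_, (below_last_add t).ge⟩
    exact (le_add_of_nonneg_right (stdSimplex.zero_le t _)).trans (below_last_add t).le
  have hα : ∀ i, (cut (Fin.last n)).toOrderHom i = 0 := fun i => if_pos (Fin.le_last i)
  rw [h.onSimplex_eq _ _ _ hk, h.onPrism_section (Fin.last n) x ⟨_, hk⟩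
    (SimplexCategory.δ (Fin.last n).succ) _ SimplexCategory.δ_comp_σ_succ
    (δ_comp_cut_castSucc (Fin.last n)), h.map_zero _ hα]
  rw [map_cut_apply_zero]
  exact below_last_add t

/-- The map `|X| × [0, 1] → |Y|` induced by a simplicial homotopy. -/
noncomputable def realize (q : Realization X × I) : Realization Y :=
  Quot.lift (r := RealizationRel X) (fun p => h.onSimplex (n := p.1.len) p.2.1 p.2.2 q.2)
    (by rintro _ _ ⟨θ, x, t⟩; exact h.onSimplex_map θ x t q.2) q.1

theorem continuous_realize : Continuous h.realize := by
  -- Local compactness of `[0, 1]` keeps the product with the quotient map a quotient map; the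
  -- product is then distributed over the disjoint union.
  refine (isQuotientMap_quot_mk (r := RealizationRel X)).continuous_lift_prod_left ?_
  rw [← (Homeomorph.sigmaProdDistrib (ι := SimplexCategory) (Y := I)
    (X := fun n => X.obj (op n) × stdSimplex ℝ (Fin (n.len + 1)))).symm.comp_continuous_iff']
  exact continuous_sigma fun n => h.continuous_onSimplex (n := n.len)

/-- A simplicial homotopy induces a homotopy on geometric realizations. -/
theorem homotopic (h : SimplicialHomotopy f g) :
    (Realization.map f).Homotopic (Realization.map g) :=
  ⟨{ toFun := fun q => h.realize (q.2, q.1)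
     continuous_toFun := h.continuous_realize.comp continuous_swap
     map_zero_left := by
      rintro ⟨p⟩
      exact h.onSimplex_zero p.2.1 p.2.2
     map_one_left := by
      rintro ⟨p⟩
      exact h.onSimplex_one p.2.1 p.2.2 }⟩

end SimplicialHomotopy

end Homotopy

end CobCat

/-! ### The simplicial homotopy attached to a relative isomorphism. -/

namespace CobCat

open UnpointedWaldhausen Simplicial

variable {C : Type u} [Category.{v} C] {D : Type u} [Category.{v} D]

/-- The functor `Tw [n] ⥤ [1]` sending `i ≤ j` to `1 - α i`. -/
def twRev {n : SimplexCategory} (α : n ⟶ ⦋1⦌) : Tw (Fin (n.len + 1)) ⥤ Fin 2 :=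
  Monotone.functor (f := fun p => Fin.rev (α.toOrderHom p.fst)) fun _ _ h =>
    Fin.rev_le_rev.2 (α.toOrderHom.monotone h.1)

/-- The functor `(i ≤ j) ↦ Φ (1 - α i) (X (i ≤ j))`. -/
def twist {n : SimplexCategory} (α : n ⟶ ⦋1⦌) (Φ : Fin 2 ⥤ C ⥤ D)
    (X : Tw (Fin (n.len + 1)) ⥤ C) : Tw (Fin (n.len + 1)) ⥤ D where
  obj p := (Φ.obj ((twRev α).obj p)).obj (X.obj p)
  map f := (Φ.map ((twRev α).map f)).app _ ≫ (Φ.obj _).map (X.map f)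

/-- `Tw.right` fixes the first index, so the transition between functors is an identity. -/
theorem twist_map_right {n : SimplexCategory} (α : n ⟶ ⦋1⦌) (Φ : Fin 2 ⥤ C ⥤ D)
    (X : Tw (Fin (n.len + 1)) ⥤ C) {i j k : Fin (n.len + 1)} (hij : i ≤ j) (hjk : j ≤ k) :
    (twist α Φ X).map (Tw.right hij hjk) =
      (Φ.obj (Fin.rev (α.toOrderHom i))).map (X.map (Tw.right hij hjk)) := by
  change (Φ.map (𝟙 _)).app _ ≫ _ = _
  rw [Φ.map_id]
  exact Category.id_comp _

variable [UnpointedWaldhausen C]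

/-- `ComposableArrows.mk₁ φ` is `φ` as a functor on `[1]`. Its non-identity arrow is `φ`, and
naturality squares of identities are trivially pushouts. -/
theorem IsRelativeIso.map_mk₁ {F G : C ⥤ D} {φ : F ⟶ G} (hφ : IsRelativeIso φ) {e e' : Fin 2}
    (f : e ⟶ e') : IsRelativeIso ((ComposableArrows.mk₁ φ).map f) := by
  have hid : ∀ (F : C ⥤ D), IsRelativeIso (𝟙 F) := fun F c c' g _ =>
    IsPushout.of_vert_isIso ⟨by simp⟩
  match e, e', f with
  | 0, 0, _ => exact hid F
  | 0, 1, _ => exact hφ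
  | 1, 1, _ => exact hid G
  | 1, 0, f => exact absurd (leOfHom f) (by decide)

variable [UnpointedWaldhausen D]

theorem isCob_twist {n : SimplexCategory} (α : n ⟶ ⦋1⦌) {Φ : Fin 2 ⥤ C ⥤ D}
    (hΦ : ∀ e, IsExact (Φ.obj e)) (hΦ' : ∀ {e e'} (f : e ⟶ e'), IsRelativeIso (Φ.map f))
    {X : Tw (Fin (n.len + 1)) ⥤ C} (hX : IsCob X) : IsCob (twist α Φ X) where
  cof_right hij hjk := by
    rw [twist_map_right]
    exact (hΦ _).map_cof _ (hX.cof_right hij hjk)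
  isPushout hij hjk hkl := by
    rw [twist_map_right, twist_map_right]
    -- The vertical maps of `twist` are by definition a component of `Φ.map` followed by the image
    -- of a map of `X`, which is the shape of a vertical pasting.
    exact (hΦ' _ _ (hX.cof_right hjk hkl)).paste_vert
      ((hΦ _).map_isPushout (hX.cof_right hjk hkl) (hX.isPushout hij hjk hkl))

/-- The functor `X ↦ twist α Φ X` on cobordism categories. -/
def WCob.twist {n : SimplexCategory} (α : n ⟶ ⦋1⦌) {Φ : Fin 2 ⥤ C ⥤ D}
    (hΦ : ∀ e, IsExact (Φ.obj e)) (hΦ' : ∀ {e e'} (f : e ⟶ e'), IsRelativeIso (Φ.map f)) :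
    WCob C n ⥤ WCob D n where
  obj X := ⟨CobCat.twist α Φ X.functor, isCob_twist α hΦ hΦ' X.isCob⟩
  map f :=
    { nat :=
        { app := fun p => (Φ.obj _).map (f.nat.app p)
          naturality := fun p q g => by
            dsimp only [CobCat.twist]
            rw [Category.assoc, ← Functor.map_comp, f.nat.naturality, Functor.map_comp,
              NatTrans.naturality_assoc] }
      weq_app := fun p => (hΦ _).map_weq _ (f.weq_app p) }
  map_id X := Hom.ext (NatTrans.ext (funext fun p => CategoryTheory.Functor.map_id _ _))
  map_comp f g := Hom.ext (NatTrans.ext (funext fun p => Functor.map_comp _ _ _))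

/-- `HEq` is needed because the endpoints of the simplicial homotopy match `F` and `G` only after
rewriting along an equality of indices in `Fin 2`. -/
theorem WCob.functor_ext {A : Type*} [Category A] {n : SimplexCategory} {P Q : A ⥤ WCob C n}
    (h : ∀ a, (P.obj a).functor = (Q.obj a).functor)
    (h' : ∀ {a b} (f : a ⟶ b) p, HEq ((P.map f).nat.app p) ((Q.map f).nat.app p)) : P = Q := by
  refine Functor.hext (fun a => ?_) fun a b f => ?_
  · have := h a
    generalize P.obj a = x at this
    generalize Q.obj a = y at this
    cases x; cases y; cases this; rfl
  · have ha := h a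
    have hb := h b
    have hf := h' f
    revert hf
    generalize P.map f = x
    generalize Q.map f = y
    revert x y
    generalize P.obj a = a₁ at ha ⊢
    generalize Q.obj a = a₂ at ha ⊢
    generalize P.obj b = b₁ at hb ⊢
    generalize Q.obj b = b₂ at hb ⊢
    cases a₁; cases a₂; cases b₁; cases b₂; cases ha; cases hb
    intro x y hf
    exact heq_of_eq (Hom.ext (NatTrans.ext (funext fun p => eq_of_heq (hf p))))

theorem WCob.twist_const {n : SimplexCategory} (α : n ⟶ ⦋1⦌) {Φ : Fin 2 ⥤ C ⥤ D}
    (hΦ : ∀ e, IsExact (Φ.obj e)) (hΦ' : ∀ {e e'} (f : e ⟶ e'), IsRelativeIso (Φ.map f))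
    (e : Fin 2) (hα : ∀ i, Fin.rev (α.toOrderHom i) = e) :
    WCob.twist α hΦ hΦ' = WCob.postcomp (hΦ e) n := by
  have hobj : ∀ p, (twRev α).obj p = e := fun p => hα p.fst
  refine WCob.functor_ext (fun X => Functor.hext (fun p => ?_) fun p q f => ?_) fun f p => ?_
  · exact congrArg (fun e => (Φ.obj e).obj (X.functor.obj p)) (hobj p)
  · change HEq ((Φ.map ((twRev α).map f)).app _ ≫ (Φ.obj _).map (X.functor.map f))
      ((Φ.obj e).map (X.functor.map f))
    -- Abstracting the arrow lets both indices be rewritten to `e`; it is then an endomorphism in a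
    -- preorder, hence the identity.
    generalize (twRev α).map f = g
    revert g
    rw [hobj p, hobj q]
    intro g
    rw [Subsingleton.elim g (𝟙 e), Φ.map_id]
    exact heq_of_eq (Category.id_comp _)
  · change HEq ((Φ.obj ((twRev α).obj p)).map (f.nat.app p)) ((Φ.obj e).map (f.nat.app p))
    rw [hobj p]

/-- The simplicial homotopy between maps of cobordism categories induced by a relative
isomorphism. -/
noncomputable def cobSpaceHomotopy {F G : C ⥤ D} (hF : IsExact F) (hG : IsExact G) (φ : F ⟶ G)
    (hφ : IsRelativeIso φ) : SimplicialHomotopy (cobSpaceMap hF) (cobSpaceMap hG) :=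
  have hΦ : ∀ e, IsExact ((ComposableArrows.mk₁ φ).obj e) := Fin.forall_fin_two.2 ⟨hF, hG⟩
  { map := fun α => (nerveFunctor.{v, max u v} ⋙ SSet.toTop.{max u v}).map
      (WCob.twist α hΦ hφ.map_mk₁).toCatHom
    naturality := fun θ α => by
      refine ((nerveFunctor.{v, max u v} ⋙ SSet.toTop.{max u v}).map_comp
        ((wCob C).map θ.op) (WCob.twist (θ ≫ α) hΦ hφ.map_mk₁).toCatHom).symm.trans (Eq.trans ?_
        ((nerveFunctor.{v, max u v} ⋙ SSet.toTop.{max u v}).map_comp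
        (WCob.twist α hΦ hφ.map_mk₁).toCatHom ((wCob D).map θ.op)))
      -- Restricting along `θ` and then twisting by `θ ≫ α` is definitionally the same as twisting
      -- by `α` and then restricting.
      rfl
    map_one := fun α hα => by
      -- The reversal in `twRev` sends the constant `1` to index `0`, which is `F`; likewise the
      -- constant `0` below gives `G`.
      rw [WCob.twist_const α hΦ hφ.map_mk₁ 0 fun i => by rw [hα i]; rfl]
      rfl
    map_zero := fun α hα => by
      rw [WCob.twist_const α hΦ hφ.map_mk₁ 1 fun i => by rw [hα i]; rfl]
      rfl }

end CobCat

theorem proposition2p6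
    {C : Type u} [Category.{v} C] [CobCat.UnpointedWaldhausen C]
    {D : Type u} [Category.{v} D] [CobCat.UnpointedWaldhausen D]
    {F G : C ⥤ D} (hF : CobCat.IsExact F) (hG : CobCat.IsExact G)
    (φ : F ⟶ G) (hφ : CobCat.IsRelativeIso φ) :
    ContinuousMap.Homotopic (CobCat.BCobMap hF) (CobCat.BCobMap hG) :=
  (CobCat.cobSpaceHomotopy hF hG φ hφ).homotopic
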